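/- Let $M$ be a matroid on a set $S$ with rank function $\rho$. Let $\mathrm{Skew}[S|\underline{m}]$ be the free skew-symmetric unitary $\mathbb{Z}$-algebra on the variables $(x|i)$, $x\in S$, $1\le i\le m$, i.e. the exterior algebra over $\mathbb{Z}$ of the free module on these variables. For a word $w=x_1\cdots x_n$ on $S$ and nonnegative integers $q_1,\dots,q_m$ write $\sum_{(w)_{(q_1,\dots,q_m)}}F(w_{(1)},\dots,w_{(m)})$ for the coproduct slice: the sum over all ways of splitting $w$ into complementary subwords $w_{(1)},\dots,w_{(m)}$ of lengths $q_1,\dots,q_m$, each term carrying the sign of the shuffle that rearranges $w$ into $w_{(1)}\cdots w_{(m)}$ (the sum is $0$ unless $n=q_1+\cdots+q_m$). Let $(w|i^{(a)})=(x_1|i)\cdots(x_n|i)$ if $n=a$ (so it is $1$ if $n=a=0$), and $(w|i^{(a)})=0$ otherwise; let $$(w|1^{(q_1)}\cdots m^{(q_m)})=\sum_{(w)_{(q_1,\dots,q_m)}}(w_{(1)}|1^{(q_1)})\cdots(w_{(m)}|m^{(q_m)}).$$ Let $J(M)$ be the two-sided ideal of $\mathrm{Skew}[S|\underline{m}]$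 generated by all the biproducts $(w|1^{(q_1)}\cdots m^{(q_m)})$ with $w$ a word whose set of letters is dependent in $M$, and let $\mathcal{W}^m(M)=\mathrm{Skew}[S|\underline{m}]/J(M)$. **Proposition 6 (exchange relation in $\mathcal{W}^2(M)$).** Let $u$ and $v$ be words of lengths $p$ and $q$ on $S$ whose sets of letters $A$ and $B$, respectively, are independent in $M$, and let $k$ be the nonnegative integer with $\rho(A\cup B)+k=p+q$. Then in $\mathcal{W}^2(M)$ $$\sum_{(v)_{(q-k,k)}}(u\,v_{(1)}|1^{(p+q-k)})\,(v_{(2)}|2^{(k)})=(-1)^{pq+k}\sum_{(u)_{(p-k,k)}}(v\,u_{(1)}|1^{(p+q-k)})\,(u_{(2)}|2^{(k)}).$$ -/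

import Mathlib

noncomputable section

namespace Letterplace

/-! ### Coproduct slices of words -/

/-- The positions `1, …, |w|` of a word `w` are distributed over `m` slots by `c`.
`subword w c i` is the subword of `w` at the positions sent to slot `i`. -/
def subword {L : Type*} {m : ℕ} (w : List L) (c : Fin w.length → Fin m) (i : Fin m) : List L :=
  ((List.finRange w.length).filter (fun a => c a = i)).map w.get

/-- The sign with which `subword w c 0 ⊗ ⋯ ⊗ subword w c (m - 1)` occurs in the iterated coproduct
of `w`: the parity of the number of inversions, i.e. the sign of the shuffle that rearranges `w`
into the concatenation of these subwords. -/
def shuffleSign {n m : ℕ} (c : Fin n → Fin m) : ℤ :=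
  (-1) ^ (Finset.univ.filter (fun ab : Fin n × Fin n => ab.1 < ab.2 ∧ c ab.2 < c ab.1)).card

/-- The sum over a coproduct slice in Sweedler notation:
`∑_{(w)_{(q₀, …, q_{m-1})}} F (w₍₁₎, …, w₍ₘ₎)`, where `w₍ᵢ₎` has length `qᵢ` and the signs of the
coproduct are written out. It is an empty sum unless `|w| = q₀ + ⋯ + q_{m-1}`. -/
def sliceSum {L : Type*} {m : ℕ} {A : Type*} [AddCommGroup A]
    (w : List L) (q : Fin m → ℕ) (F : (Fin m → List L) → A) : A :=
  ∑ c : Fin w.length → Fin m with ∀ i, (subword w c i).length = q i,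
    shuffleSign c • F (subword w c)

/-! ### The skew-symmetric letterplace algebra -/

/-- The skew-symmetric letterplace algebra `Skew[L | 1, …, m]`: the free skew-symmetric unitary
`ℤ`-algebra on the letterplace variables, i.e. the exterior algebra of the free `ℤ`-module on them.
The place `i + 1` is represented by `i : Fin m`. -/
abbrev Skew (L : Type*) (m : ℕ) : Type _ := ExteriorAlgebra ℤ ((L × Fin m) →₀ ℤ)

/-- The letterplace variable `(x|i)`. -/
def letterplace {L : Type*} {m : ℕ} (x : L) (i : Fin m) : Skew L m :=
  ExteriorAlgebra.ι ℤ (Finsupp.single (x, i) 1)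

/-- The biproduct `(w|i^(a))` with a single place: `(x₁|i)(x₂|i)⋯(xₐ|i)` if `w = x₁x₂⋯xₐ` has
length `a` (so `1` if `w` is empty and `a = 0`), and zero if the length of `w` is not `a`. -/
def placeBiproduct {L : Type*} {m : ℕ} (w : List L) (i : Fin m) (a : ℕ) : Skew L m :=
  if w.length = a then (w.map (fun x => letterplace x i)).prod else 0

/-- The biproduct `(w|1^(q₁) ⋯ m^(qₘ))`, by its Laplace expansion
`∑_{(w)_{(q₁, …, qₘ)}} (w₍₁₎|1^(q₁)) ⋯ (w₍ₘ₎|m^(qₘ))`; it is zero unless `|w| = q₁ + ⋯ + qₘ`. -/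
def biproduct {L : Type*} {m : ℕ} (w : List L) (q : Fin m → ℕ) : Skew L m :=
  sliceSum w q (fun s => (List.ofFn (fun i => placeBiproduct (s i) i (q i))).prod)

/-! ### The letterplace encoding of the Whitney algebra of a matroid -/

/-- The set of letters of a word on the ground set of `M`. -/
def wordSet {S : Type*} (M : Matroid S) (w : List M.E) : Set S :=
  {x | ∃ y ∈ w, (y : S) = x}

/-- The two-sided ideal `J(M)` of `Skew[S | 1, …, m]` generated by all the biproducts
`(w|1^(q₁) ⋯ m^(qₘ))` of words `w` whose set of letters is dependent in `M`. -/
def whitneyIdeal {S : Type*} (M : Matroid S) (m : ℕ) : TwoSidedIdeal (Skew M.E m) :=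
  TwoSidedIdeal.span
    {z | ∃ (w : List M.E) (q : Fin m → ℕ), M.Dep (wordSet M w) ∧ z = biproduct w q}

/-- The letterplace encoding `𝒲^m(M) = Skew[S | 1, …, m] / J(M)` of the `m`-th Whitney algebra. -/
abbrev Whitney {S : Type*} (M : Matroid S) (m : ℕ) : Type _ := (whitneyIdeal M m).ringCon.Quotient

/-- The image of `(w|i^(a))` in `𝒲^m(M)`. -/
def whitneyBiproduct {S : Type*} (M : Matroid S) {m : ℕ} (w : List M.E) (i : Fin m) (a : ℕ) :
    Whitney M m :=
  (whitneyIdeal M m).ringCon.mk' (placeBiproduct w i a)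

end Letterplace

end

namespace Letterplace

open Polynomial

/-! ### Coproduct slices and shuffle signs. -/

section Slices

variable {L : Type*} {m : ℕ}

/-! Adjoin a central variable `X` and put `P(w) = ∏ ((x|1) - (x|2)X)` over the letters of `w`. Both
sides come from the `X^k` coefficient of `P(u)(v|1)`. Substituting `(x|1) = P(x) + (x|2)X` in
`(v|1)` gives the signed sum of `P(u v₁)(v₂|2)X^|v₂|` over all splittings of `v`
(`prod_map_polarize_mul`). Terms with `|v₂| > k` do not reach `X^k`. If `|v₂| < k`, then `u v₁` is
longer than the rank of `A ∪ B`, so every coefficient of `P(u v₁)` vanishes in the quotient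
(`mk_coeff_prod_map_polarize_eq_zero`). The terms with `|v₂| = k` form the left side. Moving `(v|1)`
to the front instead costs `(-1)^(pq)`, and the `X^k` coefficient of `P(u)` is `(-1)^k` times a
slice of `u`: this is the right side. -/

theorem subword_cons (x : L) (w : List L) (i j : Fin m) (c : Fin w.length → Fin m) :
    subword (x :: w) (Fin.cons i c : Fin (w.length + 1) → Fin m) j
      = if i = j then x :: subword w c j else subword w c j := by
  have h : ((List.finRange w.length).map Fin.succ).filter
      (fun a => decide ((Fin.cons i c : Fin (w.length + 1) → Fin m) a = j))
      = ((List.finRange w.length).filter (fun a => decide (c a = j))).map Fin.succ := by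
    rw [List.filter_map]
    rfl
  unfold subword
  simp only [List.length_cons, List.finRange_succ, List.filter_cons, Fin.cons_zero, h]
  split_ifs with h1 h2 h2 <;> simp_all [Function.comp_def]

theorem length_subword (w : List L) (c : Fin w.length → Fin m) (i : Fin m) :
    (subword w c i).length = (Finset.univ.filter (fun a => c a = i)).card := by
  unfold subword
  rw [List.length_map]
  rfl

theorem mem_of_mem_subword {w : List L} {c : Fin w.length → Fin m} {i : Fin m} {x : L}
    (hx : x ∈ subword w c i) : x ∈ w := by
  unfold subword at hx
  obtain ⟨a, -, rfl⟩ := List.mem_map.1 hx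
  exact List.get_mem w a

theorem length_subword_add (w : List L) (c : Fin w.length → Fin 2) :
    (subword w c 0).length + (subword w c 1).length = w.length := by
  rw [length_subword, length_subword]
  have h : ∀ a, c a = 1 ↔ ¬ c a = 0 := fun a => by omega
  simp only [h]
  rw [Finset.card_filter_add_card_filter_not]
  simp

/-- A new first position is inverted exactly with the later positions sent to a smaller slot. -/
theorem shuffleSign_cons {n : ℕ} (i : Fin m) (c : Fin n → Fin m) :
    shuffleSign (Fin.cons i c : Fin (n + 1) → Fin m)
      = (-1) ^ (Finset.univ.filter (fun b => c b < i)).card * shuffleSign c := by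
  unfold shuffleSign
  rw [← pow_add]
  congr 1
  simp only [Finset.card_filter, Fintype.sum_prod_type, Fin.sum_univ_succ, Fin.cons_zero,
    Fin.cons_succ, Fin.succ_lt_succ_iff, Fin.succ_pos, Fin.not_lt_zero, false_and,
    true_and, if_false, zero_add]

/-- The sum over a coproduct slice is the sum over all the distributions of the letters with the
prescribed lengths. -/
theorem sliceSum_two {A : Type*} [AddCommGroup A] (w : List L) (n k : ℕ)
    (hw : n + k = w.length ∨ n = w.length - k) (F : (Fin 2 → List L) → A) :
    sliceSum w ![n, k] F = ∑ c : Fin w.length → Fin 2,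
      if (subword w c 1).length = k then shuffleSign c • F (subword w c) else 0 := by
  unfold sliceSum
  rw [Finset.sum_filter]
  refine Finset.sum_congr rfl fun c _ => if_congr ?_ rfl rfl
  -- If `k` exceeds the length of `w`, then `n` truncates to 0, but no subword has length `k`, so
  -- both conditions fail.
  have h := length_subword_add w c
  simp only [Fin.forall_fin_two, Matrix.cons_val_zero, Matrix.cons_val_one]
  omega

end Slices

/-! ### Products of anticommuting elements. -/

section Products

variable {L R : Type*} [Ring R]

theorem mul_prod_of_anticomm {a : R} {l : List R} (h : ∀ b ∈ l, a * b = -(b * a)) :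
    a * l.prod = (-1 : ℤ) ^ l.length • (l.prod * a) := by
  induction l with
  | nil => simp
  | cons b l ih =>
    rw [List.forall_mem_cons] at h
    rw [List.prod_cons, ← mul_assoc, h.1, neg_mul, mul_assoc, ih h.2, List.length_cons, pow_succ,
      mul_smul, mul_smul_comm, mul_assoc]
    simp

theorem prod_mul_prod_of_anticomm {l l' : List R} (h : ∀ a ∈ l, ∀ b ∈ l', a * b = -(b * a)) :
    l.prod * l'.prod = (-1 : ℤ) ^ (l.length * l'.length) • (l'.prod * l.prod) := by
  induction l with
  | nil => simp
  | cons a l ih =>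
    rw [List.forall_mem_cons] at h
    rw [List.prod_cons, mul_assoc, ih h.2, mul_smul_comm, ← mul_assoc, mul_prod_of_anticomm h.1,
      smul_mul_assoc, smul_smul, mul_assoc, ← pow_add, List.length_cons, Nat.succ_mul]

theorem prod_map_eq_zero_of_not_nodup {f : L → R} (hsq : ∀ x, f x * f x = 0)
    (hf : ∀ x y, f x * f y = -(f y * f x)) {w : List L} (hw : ¬ w.Nodup) :
    (w.map f).prod = 0 := by
  have hmem : ∀ (x : L) (l : List L), x ∈ l → f x * (l.map f).prod = 0 := by
    intro x l
    induction l with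
    | nil => simp
    | cons y l ih =>
      intro hx
      rw [List.map_cons, List.prod_cons, ← mul_assoc]
      rcases List.mem_cons.1 hx with rfl | hx
      · rw [hsq, zero_mul]
      · rw [hf, neg_mul, mul_assoc, ih hx, mul_zero, neg_zero]
  induction w with
  | nil => simp at hw
  | cons x w ih =>
    rw [List.map_cons, List.prod_cons]
    by_cases hx : x ∈ w
    · exact hmem x w hx
    · rw [ih (fun h => hw (List.nodup_cons.2 ⟨hx, h⟩)), mul_zero]

/-- A product of sums of anticommuting elements, expanded over the coproduct of the word. -/
theorem prod_map_add_eq_sum (f g : L → R) (h : ∀ x y, g x * f y = -(f y * g x)) (w : List L) :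
    (w.map (fun x => f x + g x)).prod = ∑ c : Fin w.length → Fin 2,
      shuffleSign c • (((subword w c 0).map f).prod * ((subword w c 1).map g).prod) := by
  induction w with
  | nil => simp [shuffleSign, subword]
  | cons x w ih =>
    -- When the first letter goes to slot 1, `g x` must pass every factor of slot 0; this sign is
    -- the one in `shuffleSign_cons`.
    have hcomm : ∀ c : Fin w.length → Fin 2, g x * ((subword w c 0).map f).prod
        = (-1 : ℤ) ^ (subword w c 0).length • (((subword w c 0).map f).prod * g x) := by
      intro c
      have := mul_prod_of_anticomm (a := g x) (l := (subword w c 0).map f) (by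
        intro b hb
        obtain ⟨y, -, rfl⟩ := List.mem_map.1 hb
        exact h x y)
      rwa [List.length_map] at this
    have hlt : ∀ c : Fin w.length → Fin 2, ∀ b, c b < 1 ↔ c b = 0 := fun c b => by omega
    rw [List.map_cons, List.prod_cons, ih]
    change _ = ∑ c : Fin (w.length + 1) → Fin 2, shuffleSign c •
      (((subword (x :: w) c 0).map f).prod * ((subword (x :: w) c 1).map g).prod)
    rw [← (Fin.consEquiv (fun _ : Fin (w.length + 1) => Fin 2)).sum_comp, Fintype.sum_prod_type,
      Fin.sum_univ_two, ← Finset.sum_add_distrib, Finset.mul_sum]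
    refine Finset.sum_congr rfl fun c _ => ?_
    simp only [Fin.consEquiv, Equiv.coe_fn_mk]
    rw [subword_cons, subword_cons, subword_cons, subword_cons, shuffleSign_cons, shuffleSign_cons]
    simp only [hlt, ← length_subword, Fin.not_lt_zero, Finset.filter_false, Finset.card_empty,
      pow_zero, one_mul, if_true, zero_ne_one, one_ne_zero, if_false, List.map_cons,
      List.prod_cons]
    rw [add_mul, mul_smul_comm, mul_smul_comm, ← mul_assoc (g x), hcomm, smul_mul_assoc, smul_smul,
      mul_comm (shuffleSign c), mul_assoc, mul_assoc]

end Products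

/-! ### The generating polynomial of the biproducts. -/

section Polarization

variable {L : Type*}

theorem letterplace_sq {m : ℕ} (x : L) (i : Fin m) :
    letterplace x i * letterplace x i = 0 :=
  ExteriorAlgebra.ι_sq_zero _

theorem letterplace_anticomm {m : ℕ} (x y : L) (i j : Fin m) :
    letterplace x i * letterplace y j = -(letterplace y j * letterplace x i) :=
  eq_neg_of_add_eq_zero_left (ExteriorAlgebra.ι_add_mul_swap _ _)

/-- The polynomial `(x|1) - (x|2) X`, whose products over the letters of a word have the biproducts
of the word, up to sign, as coefficients. -/
noncomputable def polarize (x : L) : (Skew L 2)[X] :=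
  monomial 0 (letterplace x 0) + monomial 1 (-letterplace x 1)

theorem monomial_letterplace_anticomm (x y : L) (i j : Fin 2) (a b : ℕ) :
    monomial a (letterplace x i) * monomial b (letterplace y j)
      = -(monomial b (letterplace y j) * monomial a (letterplace x i)) := by
  rw [monomial_mul_monomial, monomial_mul_monomial, letterplace_anticomm, monomial_neg, add_comm]

theorem monomial_letterplace_mul_polarize (x y : L) (i : Fin 2) (a : ℕ) :
    monomial a (letterplace x i) * polarize y = -(polarize y * monomial a (letterplace x i)) := by
  unfold polarize
  rw [monomial_neg, mul_add, add_mul, mul_neg, neg_mul, monomial_letterplace_anticomm,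
    monomial_letterplace_anticomm x y i 1]
  abel

theorem polarize_anticomm (x y : L) : polarize x * polarize y = -(polarize y * polarize x) := by
  conv_lhs => rw [polarize, monomial_neg, add_mul, neg_mul, monomial_letterplace_mul_polarize,
    monomial_letterplace_mul_polarize]
  conv_rhs => rw [polarize.eq_def x, monomial_neg, mul_add, mul_neg]
  abel

theorem polarize_sq (x : L) : polarize x * polarize x = 0 := by
  have h := monomial_letterplace_anticomm x x 0 1 0 1
  unfold polarize
  rw [monomial_neg, mul_add, add_mul, add_mul, mul_neg, neg_mul, neg_mul, mul_neg, h]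
  simp [monomial_mul_monomial, letterplace_sq, ← C_mul]

theorem prod_map_monomial {R : Type*} [Semiring R] (f : L → R) (a : ℕ) (w : List L) :
    (w.map (fun x => monomial a (f x))).prod = monomial (w.length * a) (w.map f).prod := by
  induction w with
  | nil => simp
  | cons x w ih =>
    rw [List.map_cons, List.prod_cons, ih, monomial_mul_monomial, List.map_cons, List.prod_cons,
      List.length_cons, Nat.succ_mul, add_comm a]

theorem prod_map_neg_eq {R : Type*} [Ring R] (f : L → R) (w : List L) :
    (w.map (fun x => -f x)).prod = (-1 : ℤ) ^ w.length • (w.map f).prod := by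
  induction w with
  | nil => simp
  | cons x w ih =>
    rw [List.map_cons, List.prod_cons, ih, mul_smul_comm, neg_mul, List.length_cons, pow_succ]
    simp

theorem coeff_prod_map_polarize (w : List L) (n k : ℕ)
    (hw : n + k = w.length ∨ n = w.length - k) :
    (w.map polarize).prod.coeff k = (-1 : ℤ) ^ k • sliceSum w ![n, k]
      (fun s => ((s 0).map (fun x => letterplace x 0)).prod
        * ((s 1).map (fun x => letterplace x 1)).prod : _ → Skew L 2) := by
  have h := prod_map_add_eq_sum (fun x : L => monomial 0 (letterplace x (0 : Fin 2)))
    (fun x => monomial 1 (-letterplace x (1 : Fin 2))) (fun x y => by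
      rw [monomial_neg, neg_mul, mul_neg, monomial_letterplace_anticomm]) w
  change (w.map polarize).prod = _ at h
  rw [h, sliceSum_two w n k hw, finsetSum_coeff, Finset.smul_sum]
  refine Finset.sum_congr rfl fun c _ => ?_
  rw [prod_map_monomial, prod_map_monomial, monomial_mul_monomial, coeff_smul, coeff_monomial,
    prod_map_neg_eq]
  simp only [mul_zero, zero_add, mul_one]
  split_ifs with h1
  · rw [h1, mul_smul_comm, smul_comm]
  · simp

theorem biproduct_eq (w : List L) (n k : ℕ) :
    biproduct w ![n, k] = sliceSum w ![n, k]
      (fun s => ((s 0).map (fun x => letterplace x 0)).prod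
        * ((s 1).map (fun x => letterplace x 1)).prod : _ → Skew L 2) := by
  unfold biproduct sliceSum
  refine Finset.sum_congr rfl fun c hc => ?_
  have h := (Finset.mem_filter.1 hc).2
  rw [Fin.forall_fin_two] at h
  simp only [List.ofFn_succ, List.ofFn_zero, List.prod_cons, List.prod_nil, mul_one]
  simp only [Fin.succ_zero_eq_one, placeBiproduct, h.1, h.2, if_true]

/-- Each `(x|1)` is `polarize x` plus `(x|2) X`, and these summands anticommute, so the product over
`v` expands over its coproduct. -/
theorem prod_map_polarize_mul (u v : List L) :
    (u.map polarize).prod * C (v.map (fun x => letterplace x (0 : Fin 2))).prod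
      = ∑ c : Fin v.length → Fin 2, shuffleSign c • (((u ++ subword v c 0).map polarize).prod
        * monomial (subword v c 1).length
          ((subword v c 1).map (fun x => letterplace x (1 : Fin 2))).prod) := by
  have h := prod_map_add_eq_sum (polarize : L → _)
    (fun x => monomial 1 (letterplace x (1 : Fin 2)))
    (fun x y => monomial_letterplace_mul_polarize x y 1 1) v
  have hsum : (fun x : L => polarize x + monomial 1 (letterplace x (1 : Fin 2)))
      = fun x => monomial 0 (letterplace x (0 : Fin 2)) := by
    funext x
    simp [polarize]
  rw [hsum, prod_map_monomial, mul_zero, monomial_zero_left] at h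
  rw [h, Finset.mul_sum]
  refine Finset.sum_congr rfl fun c _ => ?_
  rw [mul_smul_comm, prod_map_monomial, mul_one, List.map_append, List.prod_append, mul_assoc]

theorem prod_map_polarize_mul_C_prod (u v : List L) :
    (u.map polarize).prod * C (v.map (fun x => letterplace x (0 : Fin 2))).prod
      = (-1 : ℤ) ^ (u.length * v.length) •
        (C (v.map (fun x => letterplace x (0 : Fin 2))).prod * (u.map polarize).prod) := by
  have hC := prod_map_monomial (fun x : L => letterplace x (0 : Fin 2)) 0 v
  rw [mul_zero, monomial_zero_left] at hC
  rw [← hC, prod_mul_prod_of_anticomm, List.length_map, List.length_map]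
  intro a ha b hb
  obtain ⟨x, -, rfl⟩ := List.mem_map.1 ha
  obtain ⟨y, -, rfl⟩ := List.mem_map.1 hb
  rw [monomial_letterplace_mul_polarize, neg_neg]

end Polarization

/-! ### Passage to the Whitney algebra. -/

section Whitney

variable {S : Type*} (M : Matroid S)

theorem wordSet_subset_ground (w : List M.E) : wordSet M w ⊆ M.E := by
  rintro _ ⟨y, -, rfl⟩
  exact y.2

theorem encard_wordSet_of_nodup {w : List M.E} (hw : w.Nodup) :
    (wordSet M w).encard = w.length := by
  classical
  have h : wordSet M w = Subtype.val '' (w.toFinset : Set M.E) := by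
    ext x
    simp [wordSet]
  rw [h, Subtype.val_injective.encard_image, Set.encard_coe_eq_coe_finsetCard,
    List.toFinset_card_of_nodup hw]

/-- The biproducts of a word that is longer than its rank vanish in the Whitney algebra. -/
theorem mk_coeff_prod_map_polarize_eq_zero {w : List M.E}
    (hw : M.eRk (wordSet M w) < w.length) (k : ℕ) :
    (whitneyIdeal M 2).ringCon.mk' ((w.map polarize).prod.coeff k) = 0 := by
  by_cases hnd : w.Nodup
  · have hdep : M.Dep (wordSet M w) := by
      refine (Matroid.not_indep_iff (wordSet_subset_ground M w)).1 fun hi => ?_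
      rw [hi.eRk_eq_encard, encard_wordSet_of_nodup M hnd] at hw
      exact lt_irrefl _ hw
    rw [coeff_prod_map_polarize w (w.length - k) k (Or.inr rfl), ← biproduct_eq, map_zsmul]
    have hmem : biproduct w ![w.length - k, k] ∈ whitneyIdeal M 2 :=
      TwoSidedIdeal.subset_span ⟨w, _, hdep, rfl⟩
    have hzero : (whitneyIdeal M 2).ringCon.mk' (biproduct w ![w.length - k, k]) = 0 :=
      (RingCon.eq _).2 ((TwoSidedIdeal.mem_iff _ _).1 hmem)
    rw [hzero, smul_zero]
  -- With a repeated letter the letter set may be independent, so the ideal need not help; the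
  -- product already vanishes by skew-symmetry.
  · rw [prod_map_eq_zero_of_not_nodup polarize_sq polarize_anticomm hnd, coeff_zero, map_zero]

theorem coeff_zero_prod_map_polarize {L : Type*} (w : List L) :
    (w.map polarize).prod.coeff 0 = (w.map (fun x => letterplace x (0 : Fin 2))).prod := by
  induction w with
  | nil => simp
  | cons x w ih => simp [mul_coeff_zero, ih, polarize]

theorem whitneyBiproduct_of_length {m : ℕ} {w : List M.E} {a : ℕ} (h : w.length = a) (i : Fin m) :
    whitneyBiproduct M w i a
      = (whitneyIdeal M m).ringCon.mk' (w.map (fun x => letterplace x i)).prod := by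
  rw [whitneyBiproduct, placeBiproduct, if_pos h]

theorem sliceSum_append_eq_mk_coeff {u v : List M.E} {k : ℕ}
    (hk : M.eRk (wordSet M u ∪ wordSet M v) + (k : ℕ∞) = (u.length : ℕ∞) + (v.length : ℕ∞)) :
    sliceSum v ![v.length - k, k]
        (fun s => whitneyBiproduct M (u ++ s 0) (0 : Fin 2) (u.length + v.length - k)
          * whitneyBiproduct M (s 1) (1 : Fin 2) k)
      = (whitneyIdeal M 2).ringCon.mk' (((u.map polarize).prod
          * C (v.map (fun x => letterplace x (0 : Fin 2))).prod).coeff k) := by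
  rw [sliceSum_two v _ k (Or.inr rfl), prod_map_polarize_mul, finsetSum_coeff, map_sum]
  refine Finset.sum_congr rfl fun c _ => ?_
  have hlen := length_subword_add v c
  rw [coeff_smul, map_zsmul, ← C_mul_X_pow_eq_monomial, ← mul_assoc, coeff_mul_X_pow']
  -- Too short a `v₂` is killed by rank, too long a one by degree; at length `k` only the constant
  -- coefficient of the polarized product remains.
  rcases lt_trichotomy (subword v c 1).length k with hlt | heq | hgt
  · have hsub : wordSet M (u ++ subword v c 0) ⊆ wordSet M u ∪ wordSet M v := by
      rintro _ ⟨y, hy, rfl⟩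
      rcases List.mem_append.1 hy with hy | hy
      · exact Or.inl ⟨y, hy, rfl⟩
      · exact Or.inr ⟨y, mem_of_mem_subword hy, rfl⟩
    have hrk : M.eRk (wordSet M (u ++ subword v c 0)) < (u ++ subword v c 0).length := by
      refine (M.eRk_mono hsub).trans_lt ?_
      have hfin : M.eRk (wordSet M u ∪ wordSet M v) ≠ ⊤ := by
        intro htop
        rw [htop, top_add, ← Nat.cast_add] at hk
        exact ENat.natCast_ne_top _ hk.symm
      lift M.eRk (wordSet M u ∪ wordSet M v) to ℕ using hfin with r
      norm_cast at hk ⊢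
      rw [List.length_append]
      omega
    rw [if_neg hlt.ne, if_pos hlt.le, coeff_mul_C, map_mul,
      mk_coeff_prod_map_polarize_eq_zero M hrk, zero_mul, smul_zero]
  · rw [if_pos heq, if_pos heq.le, heq, Nat.sub_self, coeff_mul_C, coeff_zero_prod_map_polarize,
      map_mul, whitneyBiproduct_of_length M heq, whitneyBiproduct_of_length]
    rw [List.length_append]
    omega
  · rw [if_neg hgt.ne', if_neg hgt.not_ge, map_zero, smul_zero]

theorem sliceSum_append_eq_mul_coeff (u v : List M.E) (k : ℕ) :
    sliceSum u ![u.length - k, k]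
        (fun s => whitneyBiproduct M (v ++ s 0) (0 : Fin 2) (u.length + v.length - k)
          * whitneyBiproduct M (s 1) (1 : Fin 2) k)
      = (-1 : ℤ) ^ k • (whitneyIdeal M 2).ringCon.mk'
          ((v.map (fun x => letterplace x (0 : Fin 2))).prod
            * (u.map polarize).prod.coeff k) := by
  rw [coeff_prod_map_polarize u _ k (Or.inr rfl), mul_smul_comm, map_zsmul, smul_smul, ← mul_pow,
    neg_one_mul, neg_neg, one_pow, one_smul, sliceSum_two u _ k (Or.inr rfl),
    sliceSum_two u _ k (Or.inr rfl), Finset.mul_sum, map_sum]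
  refine Finset.sum_congr rfl fun c _ => ?_
  have hlen := length_subword_add u c
  split_ifs with h
  · rw [whitneyBiproduct_of_length M h, whitneyBiproduct_of_length, ← map_mul, List.map_append,
      List.prod_append, mul_smul_comm, map_zsmul, mul_assoc]
    rw [List.length_append]
    omega
  · rw [mul_zero, map_zero]

end Whitney

end Letterplace

theorem proposition6 {S : Type*} (M : Matroid S) (p q k : ℕ) (u v : List M.E)
    (hp : u.length = p) (hq : v.length = q)
    (hu : M.Indep (Letterplace.wordSet M u)) (hv : M.Indep (Letterplace.wordSet M v))
    (hk : M.eRk (Letterplace.wordSet M u ∪ Letterplace.wordSet M v) + (k : ℕ∞)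
      = (p : ℕ∞) + (q : ℕ∞)) :
    Letterplace.sliceSum v ![q - k, k]
        (fun s => Letterplace.whitneyBiproduct M (u ++ s 0) (0 : Fin 2) (p + q - k)
          * Letterplace.whitneyBiproduct M (s 1) (1 : Fin 2) k)
      = (-1) ^ (p * q + k) * Letterplace.sliceSum u ![p - k, k]
        (fun s => Letterplace.whitneyBiproduct M (v ++ s 0) (0 : Fin 2) (p + q - k)
          * Letterplace.whitneyBiproduct M (s 1) (1 : Fin 2) k) := by
  subst hp hq
  rw [Letterplace.sliceSum_append_eq_mk_coeff M hk,
    Letterplace.sliceSum_append_eq_mul_coeff, Letterplace.prod_map_polarize_mul_C_prod,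
    Polynomial.coeff_smul, Polynomial.coeff_C_mul, map_zsmul, zsmul_eq_mul, zsmul_eq_mul,
    ← mul_assoc]
  push_cast
  -- The `(-1)^k` of the statement cancels the one from the coefficient of `P(u)`.
  rw [pow_add, mul_assoc ((-1) ^ (u.length * v.length)), ← pow_add, Even.neg_one_pow ⟨k, rfl⟩,
    mul_one]
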